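/- A deterministic-control quantum Turing machine (dcq-TM) has a finite set of control states, a two-way infinite classical tape over $\{0,1,\Box\}$ and a two-way infinite tape of qubits. In each step, depending only on the control state and the scanned classical symbol, it applies at the quantum head a gate from $\{\mathrm{id},\mathrm{H},\mathrm{S},\pi/8,\mathrm{SWAP},\mathrm{CNOT}\}$ (the two-qubit gates act on the scanned cell and the next one), moves the quantum head, writes a classical symbol, moves the classical head and changes state. On input $(x;\rho)$, with $x$ a binary string and $\rho$ an $n$-qubit density matrix, the classical tape holds $x\,\Box\,n$ and the quantum tape holds $\rho$, both from cell $1$ on, all other cells being $\Box$, respectively $|0\rangle\langle 0|$, and both heads start at cell $0$. When the machine halts, its classical output is the string from cell $1$ to the first blank, and its quantum output $\mathsf T^{(Q)}(x;\rho)$ is the reduced state of the quantum cells $1,\dots,m$, where $m$ is the number written between the first two blanks after cell $0$ of the classical tape. Tuples of strings are encoded by $(x_1,\dots,x_r)=1^{|x_1|}0x_1\cdots 1^{|x_{r-1}|}0x_{r-1}x_r$. A dcq-TM $\mathsf U$ is universal if for every dcq-TM $\mathsf T$ there is a string $t$ with $\mathsf U((t,x);\rho)=\mathsf T(x;\rho)$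 for all inputs $(x;\rho)$. Fix a universal dcq-TM $\mathsf U$, let $D$ be the trace distance and $\epsilon$ the empty quantum input. The algorithmic complexity of a state $\rho$ is $$\mathrm K(\rho)=\inf\{|p| : D(\mathsf U^{(Q)}((p,k);\epsilon),\rho)\le 1/k \text{ for all integers } k\ge 1\},$$ which is $\infty$ if there is no such $p$. A classical description $\boldsymbol\sigma$ of a state $\sigma$ is a string encoding the tuple of the number of qubits of $\sigma$ and, for the real and imaginary parts of all entries of its density matrix in the computational basis, indices of programs of $\mathsf U$ that compute them (on input $k\ge1$ they output a rational number within $1/k$ of the given real number). The complexity $\mathrm K(\rho\mid\boldsymbol\sigma)$ of $\rho$ given the classical description of $\sigma$ is the least length of a string $p$ such that, for every classical description $x$ of $\sigma$, $D(\mathsf U^{(Q)}((p,x,k);\epsilon),\rho)\le 1/k$ for all integers $k\ge1$ (and $\infty$ if there is no such $p$ or $\sigma$ has no classical description). **Theorem.** For every universal dcq-TM $\mathsf U$ there is no real constant $g$ such that $$\mathrm K(\rho_{AB})\le \mathrm K(\rho_A)+\mathrm K(\rho_B\mid\boldsymbol\rho_A)+g\log_2\bigl(n\,\mathrm K(\rho_{AB})\bigr)$$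 holds for all integers $n_A,n_B\ge 1$, $n=n_A+n_B$, and all $n$-qubit bipartite states $\rho_{AB}$ with $\mathrm K(\rho_{AB})<\infty$, where $\rho_A$ and $\rho_B$ are the reduced states of the first $n_A$ and of the last $n_B$ qubits (with $\log_2 0$ read as $0$). -/

import Mathlib

open scoped ComplexOrder

noncomputable section

/-! ### Binary strings, tuples, numbers -/

/-- Binary strings. -/
abbrev BString : Type := List Bool

/-- The number denoted by a binary string, least significant bit first. It is a left inverse
of the one-to-one encoding `Nat.bits` of natural numbers in strings. -/
def bitsValue (s : BString) : ℕ := s.foldr (fun b v => b.toNat + 2 * v) 0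

/-- The string encoding of a tuple: every component but the last is preceded by its length,
`(x₁, …, x_m) ↦ 1^{|x₁|} 0 x₁ ⋯ 1^{|x_{m-1}|} 0 x_{m-1} x_m`. -/
def encodeTuple : List BString → BString
  | [] => []
  | [x] => x
  | x :: y :: l => List.replicate x.length true ++ false :: (x ++ encodeTuple (y :: l))

/-- The string encoding of a rational number: sign, numerator, denominator. -/
def encodeRat (q : ℚ) : BString :=
  encodeTuple [[decide (q < 0)], Nat.bits q.num.natAbs, Nat.bits q.den]

/-! ### Quantum states of finitely many qubits -/

/-- Labels of the computational basis of `n` qubits. -/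
abbrev Qubits (n : ℕ) : Type := Fin n → Fin 2

/-- Operators on `n` qubits, as matrices in the computational basis. -/
abbrev QMatrix (n : ℕ) : Type := Matrix (Qubits n) (Qubits n) ℂ

/-- Density matrices of `n`-qubit states. -/
def IsState {n : ℕ} (ρ : QMatrix n) : Prop := ρ.PosSemidef ∧ ρ.trace = 1

/-- The state of no qubits. -/
def emptyState : QMatrix 0 := 1

/-- The trace norm `Tr √(Aᴴ A)`, i.e. the sum of the singular values of `A`. -/
def traceNorm {n : ℕ} (A : QMatrix n) : ℝ :=
  ∑ i, √((Matrix.posSemidef_conjTranspose_mul_self A).isHermitian.eigenvalues i)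

/-- The trace distance. -/
def traceDist {n : ℕ} (ρ σ : QMatrix n) : ℝ := traceNorm (ρ - σ) / 2

/-- The reduced state of the first `a` of `a + b` qubits. -/
def reducedA {a b : ℕ} (ρ : QMatrix (a + b)) : QMatrix a :=
  Matrix.of fun v v' => ∑ w : Qubits b, ρ (Fin.append v w) (Fin.append v' w)

/-- The reduced state of the last `b` of `a + b` qubits. -/
def reducedB {a b : ℕ} (ρ : QMatrix (a + b)) : QMatrix b :=
  Matrix.of fun w w' => ∑ v : Qubits a, ρ (Fin.append v w) (Fin.append v w')

/-! ### Gates and the quantum tape -/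

/-- The names of the basic unitary operations. -/
inductive Gate
  | qid
  | had
  | phase
  | pi8
  | swap
  | cnot

/-- A one-qubit operation on the first of two qubits. -/
def onFirst (u : Matrix (Fin 2) (Fin 2) ℂ) : Matrix (Fin 2 × Fin 2) (Fin 2 × Fin 2) ℂ :=
  Matrix.kroneckerMap (· * ·) u 1

/-- The unitary matrix of a gate on the pair (cell under the quantum head, next cell to the
right). One-qubit gates act on the cell under the head, which is also the control of `cnot`. -/
def Gate.matrix : Gate → Matrix (Fin 2 × Fin 2) (Fin 2 × Fin 2) ℂ
  | .qid => 1
  | .had => onFirst ((1 / (√2 : ℂ)) • !![1, 1; 1, -1])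
  | .phase => onFirst !![1, 0; 0, Complex.I]
  | .pi8 => onFirst !![1, 0; 0, Complex.exp (Complex.I * Real.pi / 4)]
  | .swap => Matrix.of fun x y => if x = (y.2, y.1) then 1 else 0
  | .cnot => Matrix.of fun x y => if x = (y.1, y.1 + y.2) then 1 else 0

/-- Computational-basis labels of the two-way infinite quantum tape. -/
abbrev TapeBasis : Type := ℤ → Fin 2

/-- Operators on the quantum tape, given by their matrix elements. The states that occur in
a computation have finitely many nonzero matrix elements, all of them between labels that are
`0` on all but finitely many cells. -/
abbrev TapeOp : Type := TapeBasis → TapeBasis → ℂ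

/-- Change a label on the cells `i` and `i + 1`. -/
def setPair (w : TapeBasis) (i : ℤ) (b : Fin 2 × Fin 2) : TapeBasis :=
  Function.update (Function.update w i b.1) (i + 1) b.2

/-- `ρ ↦ G ρ Gᴴ`, with `G` acting on the cells `i` and `i + 1`. -/
def applyGate (G : Matrix (Fin 2 × Fin 2) (Fin 2 × Fin 2) ℂ) (i : ℤ) (ρ : TapeOp) : TapeOp :=
  fun w w' => ∑ b, ∑ b', G (w i, w (i + 1)) b * ρ (setPair w i b) (setPair w' i b') *
    star (G (w' i, w' (i + 1)) b')

/-- The tape with the `n`-qubit state `ρ` on the cells `1, …, n` and `|0⟩⟨0|` on every other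
cell. -/
def loadTape {n : ℕ} (ρ : QMatrix n) : TapeOp := by
  classical
  exact fun w w' =>
    if ∀ i : ℤ, (i < 1 ∨ n < i) → w i = 0 ∧ w' i = 0 then
      ρ (fun j => w (j + 1)) (fun j => w' (j + 1)) else 0

/-- The label that is `v` on the cells `1, …, m` and `r` on all the other cells. -/
def joinLabel {m : ℕ} (v : Qubits m) (r : {i : ℤ // i < 1 ∨ m < i} → Fin 2) : TapeBasis :=
  fun i => if h : i < 1 ∨ m < i then r ⟨i, h⟩ else v ⟨(i - 1).toNat, by omega⟩

/-- The reduced state of the cells `1, …, m`: the partial trace over all the other cells. -/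
def readTape (m : ℕ) (ρ : TapeOp) : QMatrix m :=
  Matrix.of fun v v' =>
    ∑ᶠ r : {i : ℤ // i < 1 ∨ m < i} → Fin 2, ρ (joinLabel v r) (joinLabel v' r)

/-! ### Deterministic-control quantum Turing machines -/

/-- Head displacements. -/
inductive Move
  | L
  | N
  | R

/-- The displacement as an integer. -/
def Move.shift : Move → ℤ
  | .L => -1
  | .N => 0
  | .R => 1

/-- Symbols of the classical tape; `none` is the blank. -/
abbrev TapeSym : Type := Option Bool

/-- A deterministic-control quantum Turing machine. Given the control state and the symbol
under the classical head, `δ` yields the gate applied at the quantum head, the move of the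
quantum head, the symbol written on the classical tape, the move of the classical head, and
the next control state. -/
structure DcqTM where
  Q : Type
  finite_Q : Finite Q
  start : Q
  halt : Q
  start_ne_halt : start ≠ halt
  δ : Q → TapeSym → Gate × Move × TapeSym × Move × Q

namespace DcqTM

/-- A configuration of a machine. -/
structure Config (T : DcqTM) where
  state : T.Q
  ctape : ℤ → TapeSym
  chead : ℤ
  qtape : TapeOp
  qhead : ℤ

/-- One step of the computation; halted configurations do not change. -/
def step (T : DcqTM) (c : T.Config) : T.Config := by
  classical
  exact
    if c.state = T.halt then c
    else
      match T.δ c.state (c.ctape c.chead) with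
      | (G, dq, s, dc, q) =>
        { state := q
          ctape := Function.update c.ctape c.chead s
          chead := c.chead + dc.shift
          qtape := applyGate G.matrix c.qhead c.qtape
          qhead := c.qhead + dq.shift }

/-- The classical tape on classical input `x` and `n`-qubit quantum input: the string `x`, a
blank, and the string denoting `n`, from cell `1` on; all other cells are blank. -/
def inputTape (x : BString) (n : ℕ) : ℤ → TapeSym :=
  fun i => if 1 ≤ i then
    (x.map some ++ none :: (Nat.bits n).map some).getD (i - 1).toNat none else none

/-- The starting configuration on input `(x; ρ)`, both heads being on the anchor cells, which
are the cells `0`. -/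
def init (T : DcqTM) (x : BString) {n : ℕ} (ρ : QMatrix n) : T.Config where
  state := T.start
  ctape := inputTape x n
  chead := 0
  qtape := loadTape ρ
  qhead := 0

/-- The string `s` is written from cell `i` on, up to the first blank. -/
def ReadsAt (tape : ℤ → TapeSym) (i : ℤ) (s : BString) : Prop :=
  ∀ j : ℕ, j ≤ s.length → tape (i + j) = s[j]?

/-- `T(x; ρ) = (y; σ)`: on classical input `x` and `n`-qubit input `ρ` the machine halts with
classical output `y` and `m`-qubit output `σ`. The string `y` is written between the anchor
and the first blank after it, and the number `m` between the first and the second blank. -/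
def Outputs (T : DcqTM) (x : BString) {n : ℕ} (ρ : QMatrix n) (y : BString) {m : ℕ}
    (σ : QMatrix m) : Prop :=
  ∃ t : ℕ, ∃ s : BString,
    ((T.step)^[t] (T.init x ρ)).state = T.halt ∧
    ReadsAt ((T.step)^[t] (T.init x ρ)).ctape 1 y ∧
    ReadsAt ((T.step)^[t] (T.init x ρ)).ctape (1 + y.length + 1) s ∧
    bitsValue s = m ∧
    readTape m ((T.step)^[t] (T.init x ρ)).qtape = σ

/-- Universal machines: for every machine `T` there is a program `t` such that
`U((t, x); ρ) = T(x; ρ)` for all inputs `(x; ρ)`. -/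
def IsUniversal (U : DcqTM) : Prop :=
  ∀ T : DcqTM, ∃ t : BString, ∀ (x : BString) (n : ℕ) (ρ : QMatrix n), IsState ρ →
    ∀ (y : BString) (m : ℕ) (σ : QMatrix m),
      U.Outputs (encodeTuple [t, x]) ρ y σ ↔ T.Outputs x ρ y σ

/-! ### Algorithmic complexity -/

/-- The program `p` computes `ρ`: on input `((p, k); ε)` the machine outputs a state at trace
distance at most `1 / k` from `ρ`, for every positive integer `k`. -/
def ComputesState (T : DcqTM) (p : BString) {n : ℕ} (ρ : QMatrix n) : Prop :=
  ∀ k : ℕ, 0 < k → ∃ (y : BString) (σ : QMatrix n),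
    T.Outputs (encodeTuple [p, Nat.bits k]) emptyState y σ ∧ traceDist σ ρ ≤ 1 / k

/-- The algorithmic complexity `K(ρ)`; it is `⊤` if no program computes `ρ`. -/
def complexity (T : DcqTM) {n : ℕ} (ρ : QMatrix n) : ℕ∞ :=
  ⨅ (p : BString) (_ : T.ComputesState p ρ), (p.length : ℕ∞)

/-- The program `p` computes `ρ` given the string `x` and the quantum state `τ`. -/
def ComputesStateGiven (T : DcqTM) (p x : BString) {l : ℕ} (τ : QMatrix l) {n : ℕ}
    (ρ : QMatrix n) : Prop :=
  ∀ k : ℕ, 0 < k → ∃ (y : BString) (σ : QMatrix n),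
    T.Outputs (encodeTuple [p, x, Nat.bits k]) τ y σ ∧ traceDist σ ρ ≤ 1 / k

/-- The string `t` is an index, in the enumeration of machines given by `U`, of a machine that
computes the real number `r`. -/
def ComputesReal (U : DcqTM) (t : BString) (r : ℝ) : Prop :=
  ∀ k : ℕ, 0 < k → ∃ q : ℚ, |r - q| ≤ 1 / k ∧
    ∃ (m : ℕ) (σ : QMatrix m),
      U.Outputs (encodeTuple [t, Nat.bits k]) emptyState (encodeRat q) σ

/-- The `i`-th computational basis label in lexicographic order. -/
def basisLabel (n : ℕ) (i : Fin (2 ^ n)) : Qubits n :=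
  fun j => finFunctionFinEquiv.symm i j.rev

/-- The string `x` is a classical description of the matrix `ρ`: a tuple made of the number
of qubits and, row by row, indices of machines computing the real and imaginary parts of the
entries. -/
def Describes (U : DcqTM) (x : BString) {n : ℕ} (ρ : QMatrix n) : Prop :=
  ∃ re im : Fin (2 ^ n) → Fin (2 ^ n) → BString,
    (∀ i j, U.ComputesReal (re i j) (ρ (basisLabel n i) (basisLabel n j)).re ∧
      U.ComputesReal (im i j) (ρ (basisLabel n i) (basisLabel n j)).im) ∧
    x = encodeTuple (Nat.bits n :: (List.finRange (2 ^ n)).flatMap fun i =>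
      (List.finRange (2 ^ n)).flatMap fun j => [re i j, im i j])

/-- The complexity of `ρ` given the classical description of `τ` (and no quantum input): the
least length of a program that computes `ρ` from any string describing `τ`. It is `⊤` if there
is no such program or if `τ` has no classical description. -/
def complexityGivenDescription (T : DcqTM) {n l : ℕ} (ρ : QMatrix n) (τ : QMatrix l) : ℕ∞ :=
  ⨅ (p : BString) (_ : (∃ x, T.Describes x τ) ∧
    ∀ x, T.Describes x τ → T.ComputesStateGiven p x emptyState ρ), (p.length : ℕ∞)

end DcqTM

end

/-! The inequality already fails for two qubits. A one-qubit unitary V applied to one half of a Bell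
pair leaves both reduced states maximally mixed, so the first two terms on the right are constants a
and b independent of V. They are finite: a circuit outputs the mixed qubit exactly, and its rational
entries give it a classical description. The inequality would read K ≤ a + b + g log₂(2K), which
bounds K by some N₀ (`eventually_add_mul_logb_lt`). But only finitely many two-qubit states have
complexity at most N₀, because a program computes at most one of them
(`DcqTM.finite_setOf_complexity_le`), whereas infinitely many states of the above form have finite
complexity.

The infinite family comes from the powers of `hadPi8`, a product of two basic gates. No two of them
agree up to a scalar (`injective_pureState_hadPi8_pow`): if a positive power were scalar, the trace
would be an algebraic integer, and so would (1 - |tr|²)² = 1/2 (`hadPi8_pow_ne_smul`). Finiteness of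
their complexities is derived from the machine model: `exists_outputs_circuit` turns a circuit into
a machine, and universality turns the machine into a program. -/

noncomputable section

/-! ### Straight-line machines -/

/-- What a machine does in one step apart from the change of state. -/
abbrev Instr : Type := Gate × Move × TapeSym × Move

/-- The contents of the tapes and the positions of the heads. -/
structure Tapes where
  ctape : ℤ → TapeSym
  chead : ℤ
  qtape : TapeOp
  qhead : ℤ

/-- The effect of an instruction on the tapes. -/
def Instr.exec (c : Tapes) (a : Instr) : Tapes where
  ctape := Function.update c.ctape c.chead a.2.2.1
  chead := c.chead + a.2.2.2.shift
  qtape := applyGate a.1.matrix c.qhead c.qtape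
  qhead := c.qhead + a.2.1.shift

/-- The instruction that writes a blank. -/
def Instr.blank : Instr := (.qid, .N, none, .N)

/-- The machine that executes the instructions of a list one after the other, then writes a blank
and halts, whatever it reads. -/
def straightLine (l : List Instr) : DcqTM where
  Q := Fin (l.length + 2)
  finite_Q := inferInstance
  start := 0
  halt := Fin.last _
  start_ne_halt := by simp [Fin.ext_iff]
  δ q _ :=
    -- The default is used at state `l.length`, the last one before `halt`, and supplies the final
    -- blank. The branch `else q` concerns only `halt`, where no step is made.
    let a := l.getD q .blank
    (a.1, a.2.1, a.2.2.1, a.2.2.2, if h : q.1 + 1 < l.length + 2 then ⟨q.1 + 1, h⟩ else q)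

def DcqTM.Config.tapes {T : DcqTM} (c : T.Config) : Tapes :=
  ⟨c.ctape, c.chead, c.qtape, c.qhead⟩

theorem straightLine_step (l : List Instr) (c : (straightLine l).Config) (i : ℕ)
    (hi : i < l.length + 1) (hc : c.state = (⟨i, by omega⟩ : Fin (l.length + 2))) :
    ((straightLine l).step c).state = (⟨i + 1, by omega⟩ : Fin (l.length + 2)) ∧
      ((straightLine l).step c).tapes = Instr.exec c.tapes (l.getD i .blank) := by
  have h : c.state ≠ (straightLine l).halt := by
    rw [hc]
    simp only [straightLine, ne_eq, Fin.ext_iff, Fin.val_last]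
    omega
  unfold DcqTM.step
  rw [if_neg h]
  have hd : (straightLine l).δ c.state (c.ctape c.chead) =
      ((l.getD i .blank).1, (l.getD i .blank).2.1, (l.getD i .blank).2.2.1,
        (l.getD i .blank).2.2.2, (⟨i + 1, by omega⟩ : Fin (l.length + 2))) := by
    rw [hc]
    simp only [straightLine]
    rw [dif_pos (by omega)]
  rw [hd]
  exact ⟨rfl, rfl⟩

theorem straightLine_iterate (l : List Instr) (c : (straightLine l).Config)
    (hc : c.state = (straightLine l).start) (i : ℕ) (hi : i < l.length + 2) :
    ((straightLine l).step^[i] c).state = (⟨i, hi⟩ : Fin (l.length + 2)) ∧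
      ((straightLine l).step^[i] c).tapes =
        ((l ++ [Instr.blank]).take i).foldl Instr.exec c.tapes := by
  induction i with
  | zero => exact ⟨hc, by simp⟩
  | succ i ih =>
    obtain ⟨h1, h2⟩ := ih (by omega)
    obtain ⟨h3, h4⟩ := straightLine_step l _ i (by omega) h1
    rw [Function.iterate_succ_apply']
    refine ⟨h3, ?_⟩
    rw [h4, h2, List.take_succ_eq_append_getElem (by simp; omega), List.foldl_append]
    simp only [List.foldl_cons, List.foldl_nil]
    congr 1
    rw [List.getElem_append]
    split_ifs with h
    · simp [List.getD, h]
    · simp [List.getD, h]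

theorem straightLine_run (l : List Instr) (c : (straightLine l).Config)
    (hc : c.state = (straightLine l).start) :
    ((straightLine l).step^[l.length + 1] c).state = (straightLine l).halt ∧
      ((straightLine l).step^[l.length + 1] c).tapes =
        (l ++ [Instr.blank]).foldl Instr.exec c.tapes := by
  have h := straightLine_iterate l c hc (l.length + 1) (by omega)
  rw [List.take_of_length_le (by simp)] at h
  exact h

/-! ### Compiling gates and output strings into instructions -/

theorem setPair_self (w : TapeBasis) (i : ℤ) : setPair w i (w i, w (i + 1)) = w := by
  simp [setPair]

theorem applyGate_one (i : ℤ) (X : TapeOp) : applyGate 1 i X = X := by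
  funext w w'
  simp only [applyGate, Matrix.one_apply]
  rw [Finset.sum_eq_single (w i, w (i + 1)), Finset.sum_eq_single (w' i, w' (i + 1))]
  · simp [setPair_self]
  · intro b _ hb; simp [hb.symm]
  · simp
  · intro b _ hb; simp [hb.symm]
  · simp

/-- The instruction that writes a symbol and moves the classical head to the right. -/
def Instr.write (s : TapeSym) : Instr := (.qid, .N, s, .R)

/-- The instruction that applies a gate. -/
def Instr.gate (G : Gate) : Instr := (G, .N, none, .N)

/-- The clause on the cells left of the head serves the induction: it protects the symbol just
written from the later writes. -/
theorem foldl_write (w : List TapeSym) (c : Tapes) :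
    ((w.map Instr.write).foldl Instr.exec c).chead = c.chead + w.length ∧
    ((w.map Instr.write).foldl Instr.exec c).qtape = c.qtape ∧
    (∀ i < c.chead, ((w.map Instr.write).foldl Instr.exec c).ctape i = c.ctape i) ∧
    ∀ j : ℕ, ∀ h : j < w.length,
      ((w.map Instr.write).foldl Instr.exec c).ctape (c.chead + j) = w[j] := by
  induction w generalizing c with
  | nil => simp
  | cons a w ih =>
    simp only [List.map_cons, List.foldl_cons]
    obtain ⟨h1, h2, h3, h4⟩ := ih (Instr.exec c (Instr.write a))
    have hh : (Instr.exec c (Instr.write a)).chead = c.chead + 1 := rfl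
    refine ⟨?_, ?_, ?_, ?_⟩
    · rw [h1, hh]; push_cast [List.length_cons]; ring
    · rw [h2]; exact applyGate_one _ _
    · intro i hi
      rw [h3 i (by omega)]
      exact Function.update_of_ne hi.ne _ _
    · rintro (_ | j) h
      · rw [h3 _ (by rw [hh]; simp)]
        simp [Instr.exec, Instr.write]
      · have := h4 j (by simpa using h)
        rw [hh] at this
        rw [show c.chead + ((j + 1 : ℕ) : ℤ) = c.chead + 1 + j by push_cast; ring, this]
        simp

/-- Gate instructions write a blank, so a classical head resting on a blank cell leaves its tape
unchanged. -/
theorem foldl_gate (gs : List Gate) (c : Tapes) (hc : c.ctape c.chead = none) :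
    (gs.map Instr.gate).foldl Instr.exec c =
      { c with qtape := gs.foldl (fun X G => applyGate G.matrix c.qhead X) c.qtape } := by
  induction gs generalizing c with
  | nil => rfl
  | cons G gs ih =>
    have h : Instr.exec c (Instr.gate G) =
        { c with qtape := applyGate G.matrix c.qhead c.qtape } := by
      simp [Instr.exec, Instr.gate, Move.shift, ← hc]
    simp only [List.map_cons, List.foldl_cons]
    rw [h]
    exact ih { c with qtape := applyGate G.matrix c.qhead c.qtape } hc

/-- With `join`, the index `w.length`, where the final blank stands, reads as `none`, just as a
blank inside `w` does. -/
theorem foldl_write_blank (w : List TapeSym) (c : Tapes) :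
    ((w.map Instr.write ++ [Instr.blank]).foldl Instr.exec c).qtape = c.qtape ∧
    ∀ j : ℕ, j ≤ w.length →
      ((w.map Instr.write ++ [Instr.blank]).foldl Instr.exec c).ctape (c.chead + j) =
        w[j]?.join := by
  obtain ⟨h1, h2, -, h4⟩ := foldl_write w c
  rw [List.foldl_append]
  simp only [List.foldl_cons, List.foldl_nil]
  refine ⟨?_, fun j hj => ?_⟩
  · rw [← h2]; exact applyGate_one _ _
  · have he : (Instr.exec ((w.map Instr.write).foldl Instr.exec c) Instr.blank).ctape =
        Function.update ((w.map Instr.write).foldl Instr.exec c).ctape (c.chead + w.length) none := by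
      rw [← h1]; rfl
    rw [he]
    rcases hj.lt_or_eq with h | rfl
    · rw [Function.update_of_ne (by omega), h4 j h]
      simp [h]
    · simp

/-- Every circuit on the cells `1` and `2` is performed by a machine that ignores its classical
input and outputs a given string and the reduced state of a given number of qubits. -/
theorem exists_outputs_circuit (gs : List Gate) (y s : BString) {m : ℕ} (hs : bitsValue s = m) :
    ∃ T : DcqTM, ∀ (x : BString) (n : ℕ) (ρ : QMatrix n),
      T.Outputs x ρ y
        (readTape m (gs.foldl (fun X G => applyGate G.matrix 1 X) (loadTape ρ))) := by
  -- The leading `none` goes to cell 0, where the classical head waits during the gates, so that `y`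
  -- begins at cell 1. The blank after `s` is the one written before halting.
  let out : List TapeSym := none :: (y.map some ++ none :: s.map some)
  let l : List Instr := (Gate.qid, Move.R, none, Move.N) :: gs.map Instr.gate ++ out.map Instr.write
  refine ⟨straightLine l, fun x n ρ => ⟨l.length + 1, s, ?_⟩⟩
  obtain ⟨h1, h2⟩ := straightLine_run l ((straightLine l).init x ρ) rfl
  set c := ((straightLine l).step^[l.length + 1] ((straightLine l).init x ρ))
  have h0 : DcqTM.inputTape x n 0 = none := by simp [DcqTM.inputTape]
  have h3 : c.tapes = (out.map Instr.write ++ [Instr.blank]).foldl Instr.exec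
      ⟨DcqTM.inputTape x n, 0, gs.foldl (fun X G => applyGate G.matrix 1 X) (loadTape ρ), 1⟩ := by
    rw [h2]
    simp only [l, List.cons_append, List.foldl_cons, List.append_assoc]
    rw [List.foldl_append]
    congr 1
    have he : Instr.exec ((straightLine l).init x ρ).tapes (Gate.qid, Move.R, none, Move.N) =
        ⟨DcqTM.inputTape x n, 0, loadTape ρ, 1⟩ := by
      have hg : applyGate Gate.qid.matrix 0 (loadTape ρ) = loadTape ρ := applyGate_one _ _
      simp only [Instr.exec, DcqTM.Config.tapes, DcqTM.init, hg, Move.shift]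
      congr 1
      rw [← h0, Function.update_eq_self]
    change List.foldl Instr.exec
      (Instr.exec ((straightLine l).init x ρ).tapes (Gate.qid, Move.R, none, Move.N)) _ = _
    rw [he, foldl_gate _ _ h0]
  obtain ⟨hq, hc⟩ := foldl_write_blank out
    ⟨DcqTM.inputTape x n, 0, gs.foldl (fun X G => applyGate G.matrix 1 X) (loadTape ρ), 1⟩
  rw [← h3] at hq hc
  simp only [zero_add] at hc
  change ∀ j : ℕ, j ≤ out.length → c.ctape j = out[j]?.join at hc
  have hlen : out.length = y.length + s.length + 2 := by simp [out]; omega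
  refine ⟨h1, fun j hj => ?_, fun j hj => ?_, hs, congrArg _ hq⟩
  · have h := hc (1 + j) (by omega)
    push_cast at h
    rw [h, Nat.add_comm]
    simp only [out, List.getElem?_cons_succ]
    rcases hj.lt_or_eq with h | rfl
    · simp [List.getElem?_append, h]
    · simp
  · have h := hc (1 + y.length + 1 + j) (by omega)
    push_cast at h
    rw [h, show 1 + y.length + 1 + j = (y.length + (j + 1)) + 1 by omega]
    simp only [out, List.getElem?_cons_succ]
    rw [List.getElem?_append_right (by simp)]
    simp only [List.length_map, Nat.add_sub_cancel_left, List.getElem?_cons_succ,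
      List.getElem?_map]
    cases s[j]? <;> rfl

/-! ### Pure states of two qubits on the tape -/

/-- The pure state of two qubits with the given amplitudes. -/
def pureState (ψ : Fin 2 × Fin 2 → ℂ) : QMatrix (1 + 1) :=
  Matrix.of fun v w => ψ (v 0, v 1) * star (ψ (w 0, w 1))

/-- The amplitude of a tape label if the cells `1` and `2` have the amplitudes `ψ` and all others
are in the state `|0⟩`. -/
def tapeVec (ψ : Fin 2 × Fin 2 → ℂ) (w : TapeBasis) : ℂ := by
  classical
  exact if ∀ i : ℤ, (i < 1 ∨ 2 < i) → w i = 0 then ψ (w 1, w 2) else 0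

/-- The rank-one form lets gates be tracked on amplitude vectors instead of tape operators. -/
theorem loadTape_pureState (ψ : Fin 2 × Fin 2 → ℂ) :
    loadTape (pureState ψ) = fun w w' => tapeVec ψ w * star (tapeVec ψ w') := by
  classical
  funext w w'
  simp only [loadTape, tapeVec, pureState]
  have h : (∀ i : ℤ, (i < 1 ∨ ((1 + 1 : ℕ) : ℤ) < i) → w i = 0 ∧ w' i = 0) ↔
      (∀ i : ℤ, (i < 1 ∨ 2 < i) → w i = 0) ∧ ∀ i : ℤ, (i < 1 ∨ 2 < i) → w' i = 0 := by
    norm_num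
    grind
  rw [if_congr h rfl rfl]
  split_ifs <;> simp_all

/-- With no quantum input all cells are in the state `|0⟩`, so a circuit may be regarded as acting
on two qubits in `|00⟩`. -/
theorem loadTape_emptyState :
    loadTape emptyState = loadTape (pureState (Pi.single (0, 0) 1)) := by
  classical
  rw [loadTape_pureState]
  funext w w'
  have h (w : TapeBasis) : tapeVec (Pi.single (0, 0) 1) w = if ∀ i, w i = 0 then 1 else 0 := by
    unfold tapeVec
    by_cases h : ∀ i, w i = 0
    · simp [h]
    · rw [if_neg h]
      split_ifs with h'
      · rw [Pi.single_eq_of_ne]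
        intro h2
        simp only [Prod.mk.injEq] at h2
        refine h fun i => ?_
        by_cases hi : i < 1 ∨ 2 < i
        · exact h' i hi
        · obtain rfl | rfl : i = 1 ∨ i = 2 := by omega
          exacts [h2.1, h2.2]
      · rfl
  rw [h, h]
  simp only [loadTape, emptyState]
  have hc : (∀ i : ℤ, (i < 1 ∨ ((0 : ℕ) : ℤ) < i) → w i = 0 ∧ w' i = 0) ↔
      (∀ i, w i = 0) ∧ ∀ i, w' i = 0 := by
    refine ⟨fun h => ⟨fun i => (h i (by simp; omega)).1, fun i => (h i (by simp; omega)).2⟩,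
      fun h i _ => ⟨h.1 i, h.2 i⟩⟩
  rw [if_congr hc rfl rfl]
  have h1 : (1 : QMatrix 0) (fun j => w (j + 1)) (fun j => w' (j + 1)) = 1 := by
    rw [Matrix.one_apply, if_pos (Subsingleton.elim _ _)]
  rw [h1]
  split_ifs <;> simp_all

theorem tapeVec_mulVec (G : Matrix (Fin 2 × Fin 2) (Fin 2 × Fin 2) ℂ) (ψ : Fin 2 × Fin 2 → ℂ)
    (w : TapeBasis) :
    tapeVec (G.mulVec ψ) w = ∑ b, G (w 1, w 2) b * tapeVec ψ (setPair w 1 b) := by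
  have h (b : Fin 2 × Fin 2) : (∀ i : ℤ, (i < 1 ∨ 2 < i) → setPair w 1 b i = 0) ↔
      ∀ i : ℤ, (i < 1 ∨ 2 < i) → w i = 0 := by
    refine forall₂_congr fun i hi => ?_
    rw [setPair, Function.update_of_ne (by omega), Function.update_of_ne (by omega)]
  have h2 (b : Fin 2 × Fin 2) : setPair w 1 b 1 = b.1 ∧ setPair w 1 b 2 = b.2 := by
    constructor <;> simp [setPair, Function.update]
  unfold tapeVec
  by_cases hw : ∀ i : ℤ, (i < 1 ∨ 2 < i) → w i = 0
  · rw [if_pos hw]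
    change ∑ b, G (w 1, w 2) b * ψ b = _
    refine Finset.sum_congr rfl fun b _ => ?_
    rw [if_pos ((h b).mpr hw), (h2 b).1, (h2 b).2]
  · rw [if_neg hw]
    refine (Finset.sum_eq_zero fun b _ => ?_).symm
    rw [if_neg (mt (h b).mp hw), mul_zero]

theorem applyGate_loadTape (G : Matrix (Fin 2 × Fin 2) (Fin 2 × Fin 2) ℂ)
    (ψ : Fin 2 × Fin 2 → ℂ) :
    applyGate G 1 (loadTape (pureState ψ)) = loadTape (pureState (G.mulVec ψ)) := by
  rw [loadTape_pureState, loadTape_pureState]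
  funext w w'
  rw [tapeVec_mulVec, tapeVec_mulVec, star_sum, Finset.sum_mul_sum]
  simp only [applyGate, star_mul']
  refine Finset.sum_congr rfl fun b _ => Finset.sum_congr rfl fun b' _ => ?_
  norm_num
  ring

theorem foldl_applyGate_loadTape (gs : List Gate) (ψ : Fin 2 × Fin 2 → ℂ) :
    gs.foldl (fun X G => applyGate G.matrix 1 X) (loadTape (pureState ψ)) =
      loadTape (pureState (gs.foldl (fun φ G => G.matrix.mulVec φ) ψ)) := by
  induction gs generalizing ψ with
  | nil => rfl
  | cons G gs ih => rw [List.foldl_cons, applyGate_loadTape, ih, List.foldl_cons]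

theorem readTape_loadTape_two (ψ : Fin 2 × Fin 2 → ℂ) :
    readTape (1 + 1) (loadTape (pureState ψ)) = pureState ψ := by
  rw [loadTape_pureState]
  ext v v'
  simp only [readTape, Matrix.of_apply]
  -- A label that is nonzero outside the cells 1 and 2 has amplitude 0, so the partial trace has a
  -- single term.
  rw [finsum_eq_single _ 0]
  · have h (v : Qubits (1 + 1)) : tapeVec ψ (joinLabel v 0) = ψ (v 0, v 1) := by
      unfold tapeVec
      rw [if_pos]
      · congr 2
      · intro i hi
        simp only [joinLabel]
        rw [dif_pos (by norm_num; exact hi)]; rfl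
    rw [h, h]; rfl
  · intro r hr
    have : tapeVec ψ (joinLabel v r) = 0 := by
      unfold tapeVec
      rw [if_neg]
      intro h
      apply hr
      funext ⟨i, hi⟩
      have := h i (by norm_num at hi; exact hi)
      rwa [joinLabel, dif_pos hi] at this
    rw [this, zero_mul]

theorem readTape_loadTape_one (ψ : Fin 2 × Fin 2 → ℂ) :
    readTape 1 (loadTape (pureState ψ)) = reducedA (a := 1) (b := 1) (pureState ψ) := by
  classical
  rw [loadTape_pureState]
  ext v v'
  simp only [readTape, reducedA, Matrix.of_apply]
  -- Of the traced-out cells only cell 2 can be nonzero; `e` parametrizes the labels that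
  -- contribute.
  let e (w : Qubits 1) : {i : ℤ // i < 1 ∨ ((1 : ℕ) : ℤ) < i} → Fin 2 :=
    fun i => if i.1 = 2 then w 0 else 0
  have he : Function.Injective e := by
    intro w w' h
    have := congrFun h ⟨2, by norm_num⟩
    simp only [e, if_true] at this
    funext i
    rw [Subsingleton.elim i 0, this]
  have hs : Function.support (fun r => tapeVec ψ (joinLabel v r) * star (tapeVec ψ (joinLabel v' r)))
      ⊆ ((Finset.univ.image e : Finset _) : Set _) := by
    intro r hr
    simp only [Finset.coe_image, Finset.coe_univ, Set.image_univ, Set.mem_range]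
    refine ⟨fun _ => r ⟨2, by norm_num⟩, ?_⟩
    funext ⟨i, hi⟩
    simp only [e]
    split_ifs with h2
    · subst h2; rfl
    · by_contra h3
      apply hr
      have : tapeVec ψ (joinLabel v r) = 0 := by
        unfold tapeVec
        rw [if_neg]
        intro h
        have := h i (by norm_num at hi; omega)
        rw [joinLabel, dif_pos hi] at this
        exact h3 this.symm
      simp [this]
  rw [finsum_eq_sum_of_support_subset _ hs, Finset.sum_image fun _ _ _ _ h => he h]
  refine Finset.sum_congr rfl fun w _ => ?_
  have h (v : Qubits 1) : tapeVec ψ (joinLabel v (e w)) = ψ (v 0, w 0) := by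
    unfold tapeVec
    rw [if_pos]
    · rfl
    · intro i hi
      simp only [joinLabel, e]
      split_ifs
      · omega
      · rfl
      · push_cast at *; omega
  rw [h, h]
  rfl

/-! ### A product of gates of infinite order -/

/-- The product of the Hadamard and the `π/8` gate. -/
def hadPi8 : Matrix (Fin 2) (Fin 2) ℂ :=
  ((1 / (√2 : ℂ)) • !![1, 1; 1, -1]) * !![1, 0; 0, Complex.exp (Complex.I * Real.pi / 4)]

theorem exp_pi_div_four :
    Complex.exp (Complex.I * Real.pi / 4) = (1 + Complex.I) / (√2 : ℂ) := by
  have h2 : (√2 : ℂ) * (√2 : ℂ) = 2 := by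
    exact_mod_cast congrArg ((↑) : ℝ → ℂ) (Real.mul_self_sqrt (by norm_num : (0:ℝ) ≤ 2))
  have h0 : (√2 : ℂ) ≠ 0 := by intro h; rw [h] at h2; norm_num at h2
  rw [show Complex.I * Real.pi / 4 = ((Real.pi / 4 : ℝ) : ℂ) * Complex.I by push_cast; ring,
    Complex.exp_mul_I, ← Complex.ofReal_cos, ← Complex.ofReal_sin, Real.cos_pi_div_four,
    Real.sin_pi_div_four]
  push_cast
  field_simp
  linear_combination (1 + Complex.I) * h2

theorem hadPi8_eq : hadPi8 =
    !![1 / (√2 : ℂ), (1 + Complex.I) / 2; 1 / (√2 : ℂ), -(1 + Complex.I) / 2] := by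
  have h2 : (√2 : ℂ) * (√2 : ℂ) = 2 := by
    exact_mod_cast congrArg ((↑) : ℝ → ℂ) (Real.mul_self_sqrt (by norm_num : (0:ℝ) ≤ 2))
  have h0 : (√2 : ℂ) ≠ 0 := by intro h; rw [h] at h2; norm_num at h2
  rw [hadPi8, exp_pi_div_four]
  ext i j
  fin_cases i <;> fin_cases j <;> simp [Matrix.mul_apply, Fin.sum_univ_two] <;> field_simp <;>
    simp only [pow_two, h2] <;> ring

theorem hadPi8_mem_unitary : hadPi8 ∈ Matrix.unitaryGroup (Fin 2) ℂ := by
  have h2 : (√2 : ℂ) * (√2 : ℂ) = 2 := by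
    exact_mod_cast congrArg ((↑) : ℝ → ℂ) (Real.mul_self_sqrt (by norm_num : (0:ℝ) ≤ 2))
  have h0 : (√2 : ℂ) ≠ 0 := by intro h; rw [h] at h2; norm_num at h2
  have hI := Complex.I_mul_I
  have hc : starRingEnd ℂ 2 = 2 := map_ofNat _ 2
  rw [Matrix.mem_unitaryGroup_iff, hadPi8_eq]
  ext i j
  fin_cases i <;> fin_cases j <;>
    simp [Matrix.mul_apply, Fin.sum_univ_two, Matrix.star_apply] <;>
    field_simp <;> simp only [pow_two, h2, hc] <;> first
      | linear_combination hI
      | linear_combination -hI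
      | linear_combination 2 * hI
      | linear_combination -2 * hI

/-- Applying `V ^ d` to an eigenvector gives `x ^ d = μ`, and a root of an integral element is
integral. -/
theorem isIntegral_of_eigenvalue {V : Matrix (Fin 2) (Fin 2) ℂ} {d : ℕ} (hd : 0 < d) {μ x : ℂ}
    (hV : V ^ d = μ • 1) (hμ : IsIntegral ℤ μ) (hx : (V - x • 1).det = 0) : IsIntegral ℤ x := by
  obtain ⟨v, hv, h⟩ := Matrix.exists_mulVec_eq_zero_iff.mpr hx
  have h1 : V.mulVec v = x • v := by
    rw [Matrix.sub_mulVec, Matrix.smul_mulVec, Matrix.one_mulVec, sub_eq_zero] at h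
    exact h
  have h2 (n : ℕ) : (V ^ n).mulVec v = x ^ n • v := by
    induction n with
    | zero => simp
    | succ n ih => rw [pow_succ', ← Matrix.mulVec_mulVec, ih, Matrix.mulVec_smul, h1, smul_smul, pow_succ]
  have h3 := h2 d
  rw [hV, Matrix.smul_mulVec, Matrix.one_mulVec] at h3
  have h4 : x ^ d = μ := (smul_left_injective ℂ hv h3).symm
  exact IsIntegral.of_pow hd (h4 ▸ hμ)

/-- Determinants give `μ ^ 2 = V.det ^ d`, so `μ` is integral. Hence both eigenvalues are integral,
and the trace is their sum. -/
theorem isIntegral_trace_of_pow_eq_smul {V : Matrix (Fin 2) (Fin 2) ℂ} {d : ℕ} (hd : 0 < d) {μ : ℂ}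
    (hV : V ^ d = μ • 1) (hdet : IsIntegral ℤ V.det) : IsIntegral ℤ V.trace := by
  have hμ : IsIntegral ℤ μ := by
    have h := congrArg Matrix.det hV
    rw [Matrix.det_pow, Matrix.det_smul, Matrix.det_one, mul_one, Fintype.card_fin] at h
    exact IsIntegral.of_pow (n := 2) (by norm_num) (h ▸ hdet.pow d)
  have hch (x : ℂ) : (V - x • 1).det = x * x - V.trace * x + V.det := by
    rw [Matrix.det_fin_two, Matrix.det_fin_two, Matrix.trace_fin_two]
    simp
    ring
  obtain ⟨s, hs⟩ := IsAlgClosed.exists_pow_nat_eq (V.trace ^ 2 - 4 * V.det) (n := 2) (by norm_num)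
  have h1 : IsIntegral ℤ ((V.trace + s) / 2) :=
    isIntegral_of_eigenvalue hd hV hμ (by rw [hch]; linear_combination hs / 4)
  have h2 : IsIntegral ℤ ((V.trace - s) / 2) :=
    isIntegral_of_eigenvalue hd hV hμ (by rw [hch]; linear_combination hs / 4)
  have h3 := h1.add h2
  rwa [show (V.trace + s) / 2 + (V.trace - s) / 2 = V.trace by ring] at h3

theorem hadPi8_pow_ne_smul {d : ℕ} (hd : 0 < d) (μ : ℂ) : hadPi8 ^ d ≠ μ • 1 := by
  intro hV
  have h2 : (√2 : ℂ) * (√2 : ℂ) = 2 := by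
    exact_mod_cast congrArg ((↑) : ℝ → ℂ) (Real.mul_self_sqrt (by norm_num : (0:ℝ) ≤ 2))
  have h0 : (√2 : ℂ) ≠ 0 := by intro h; rw [h] at h2; norm_num at h2
  have hI := Complex.I_mul_I
  have hdet : IsIntegral ℤ hadPi8.det := by
    refine IsIntegral.of_pow (n := 8) (by norm_num) ?_
    have h : hadPi8.det ^ 8 = 1 := by
      have h1 : hadPi8.det * (√2 : ℂ) = -(1 + Complex.I) := by
        rw [hadPi8_eq, Matrix.det_fin_two_of]; field_simp; ring
      have h3 : hadPi8.det ^ 2 = Complex.I := by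
        have : hadPi8.det ^ 2 * 2 = Complex.I * 2 := by
          calc _ = (hadPi8.det * (√2 : ℂ)) ^ 2 := by rw [mul_pow, pow_two (√2 : ℂ), h2]
            _ = _ := by rw [h1]; linear_combination hI
        exact mul_right_cancel₀ two_ne_zero this
      calc hadPi8.det ^ 8 = (hadPi8.det ^ 2) ^ 4 := by ring
        _ = 1 := by rw [h3]; exact Complex.I_pow_four
    rw [h]; exact isIntegral_one
  have htr := isIntegral_trace_of_pow_eq_smul hd hV hdet
  have htr' : IsIntegral ℤ (star hadPi8.trace) :=
    htr.map (RingHom.toIntAlgHom (starRingEnd ℂ))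
  -- Here |tr|² = 1 - 1/√2. Squaring yields the rational number 1/2, which would have to be an
  -- integer because ℤ is integrally closed.
  have h4 : (1 - hadPi8.trace * star hadPi8.trace) ^ 2 = algebraMap ℚ ℂ (1 / 2) := by
    have h5 : 1 - hadPi8.trace * star hadPi8.trace = 1 / (√2 : ℂ) := by
      rw [hadPi8_eq, Matrix.trace_fin_two_of]
      simp
      field_simp
      simp only [pow_two, h2]
      linear_combination (√2 : ℂ) ^ 2 * hI - 2 * h2
    rw [h5, div_pow, pow_two (√2 : ℂ), h2]
    norm_num
  have h6 := (isIntegral_one.sub (htr.mul htr')).pow 2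
  rw [h4, isIntegral_algebraMap_iff (algebraMap ℚ ℂ).injective,
    IsIntegrallyClosed.isIntegral_iff] at h6
  obtain ⟨z, hz⟩ := h6
  have h7 : (2 * z : ℚ) = 1 := by
    rw [eq_intCast] at hz; rw [hz]; norm_num
  have h8 : 2 * z = 1 := by exact_mod_cast h7
  omega

/-! ### Entangled states with maximally mixed marginals -/

/-- The amplitudes of the state obtained from the Bell state by a one-qubit operation on the first
qubit. -/
def bellVec (V : Matrix (Fin 2) (Fin 2) ℂ) (x : Fin 2 × Fin 2) : ℂ := 1 / (√2 : ℂ) * V x.1 x.2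

/-- The maximally mixed state of one qubit. -/
def mixedQubit : QMatrix 1 := (1 / 2 : ℂ) • 1

theorem mul_star_inv_sqrt_two : 1 / (√2 : ℂ) * star (1 / (√2 : ℂ)) = 1 / 2 := by
  have h2 : (√2 : ℂ) * (√2 : ℂ) = 2 := by
    exact_mod_cast congrArg ((↑) : ℝ → ℂ) (Real.mul_self_sqrt (by norm_num : (0:ℝ) ≤ 2))
  simp only [Complex.star_def, map_div₀, map_one, Complex.conj_ofReal]
  rw [div_mul_div_comm, h2, one_mul]

theorem pureState_bellVec_apply (V : Matrix (Fin 2) (Fin 2) ℂ) (v w : Qubits (1 + 1)) :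
    pureState (bellVec V) v w = 1 / 2 * (V (v 0) (v 1) * star (V (w 0) (w 1))) := by
  rw [← mul_star_inv_sqrt_two]
  simp only [pureState, bellVec, Matrix.of_apply, star_mul']
  ring

theorem one_apply_qubits_one (v w : Qubits 1) :
    (1 : QMatrix 1) v w = (1 : Matrix (Fin 2) (Fin 2) ℂ) (v 0) (w 0) := by
  rw [Matrix.one_apply, Matrix.one_apply]
  refine if_congr ⟨fun h => h ▸ rfl, fun h => ?_⟩ rfl rfl
  funext i
  rw [Subsingleton.elim i 0, h]

theorem sum_qubits_one (f : Fin 2 → ℂ) : ∑ w : Qubits 1, f (w 0) = ∑ i, f i :=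
  Fintype.sum_equiv (Equiv.funUnique (Fin 1) (Fin 2)) _ _ fun _ => rfl

/-- The two reduced matrices are half of V Vᴴ and half of the transpose of Vᴴ V, so unitarity alone
determines them. -/
theorem reducedA_bellVec {V : Matrix (Fin 2) (Fin 2) ℂ} (hV : V ∈ Matrix.unitaryGroup (Fin 2) ℂ) :
    reducedA (a := 1) (b := 1) (pureState (bellVec V)) = mixedQubit := by
  ext v v'
  have h := congrFun (congrFun (Matrix.mem_unitaryGroup_iff.mp hV) (v 0)) (v' 0)
  rw [Matrix.mul_apply] at h
  simp only [Matrix.star_apply] at h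
  simp only [reducedA, Matrix.of_apply, pureState_bellVec_apply, mixedQubit, Matrix.smul_apply,
    smul_eq_mul, one_apply_qubits_one, ← h]
  rw [← Finset.mul_sum]
  exact congrArg _ (sum_qubits_one fun i => V (v 0) i * star (V (v' 0) i))

theorem reducedB_bellVec {V : Matrix (Fin 2) (Fin 2) ℂ} (hV : V ∈ Matrix.unitaryGroup (Fin 2) ℂ) :
    reducedB (a := 1) (b := 1) (pureState (bellVec V)) = mixedQubit := by
  ext w w'
  have h := congrFun (congrFun (Matrix.mem_unitaryGroup_iff'.mp hV) (w' 0)) (w 0)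
  rw [Matrix.mul_apply] at h
  simp only [Matrix.star_apply] at h
  have hs : (1 : Matrix (Fin 2) (Fin 2) ℂ) (w 0) (w' 0) = (1 : Matrix _ _ ℂ) (w' 0) (w 0) := by
    rw [Matrix.one_apply, Matrix.one_apply]; exact if_congr eq_comm rfl rfl
  simp only [reducedB, Matrix.of_apply, pureState_bellVec_apply, mixedQubit, Matrix.smul_apply,
    smul_eq_mul, one_apply_qubits_one, hs, ← h]
  rw [← Finset.mul_sum]
  congr 1
  rw [← sum_qubits_one]
  exact Finset.sum_congr rfl fun i _ => mul_comm _ _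

theorem trace_reducedA {a b : ℕ} (ρ : QMatrix (a + b)) : (reducedA ρ).trace = ρ.trace := by
  simp only [Matrix.trace, Matrix.diag_apply, reducedA, Matrix.of_apply]
  rw [← Fintype.sum_prod_type']
  exact Fintype.sum_equiv (Fin.appendEquiv a b) _ _ fun _ => rfl

theorem isState_bellVec {V : Matrix (Fin 2) (Fin 2) ℂ} (hV : V ∈ Matrix.unitaryGroup (Fin 2) ℂ) :
    IsState (pureState (bellVec V)) := by
  refine ⟨Matrix.posSemidef_vecMulVec_self_star fun v : Qubits (1 + 1) => bellVec V (v 0, v 1), ?_⟩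
  rw [← trace_reducedA (a := 1) (b := 1), reducedA_bellVec hV, mixedQubit, Matrix.trace_smul,
    Matrix.trace_one]
  simp [Qubits]

/-- Two unitary operations that give the same state differ by a scalar. -/
theorem exists_smul_of_pureState_bellVec_eq {V W : Matrix (Fin 2) (Fin 2) ℂ}
    (hV : V ∈ Matrix.unitaryGroup (Fin 2) ℂ)
    (h : pureState (bellVec V) = pureState (bellVec W)) : ∃ c : ℂ, V = c • W := by
  have hne : V ≠ 0 := by
    rintro rfl
    have := Matrix.mem_unitaryGroup_iff.mp hV
    simp at this
  obtain ⟨a, b, hab⟩ : ∃ a b, V a b ≠ 0 := by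
    by_contra! h0
    exact hne (Matrix.ext h0)
  -- Comparing the density matrix entries at ((i, j), (a, b)) gives V i j * star (V a b) = W i j *
  -- star (W a b).
  refine ⟨star (W a b) / star (V a b), ?_⟩
  ext i j
  have h1 := congrFun (congrFun h ![i, j]) ![a, b]
  rw [pureState_bellVec_apply, pureState_bellVec_apply] at h1
  simp only [Matrix.cons_val_zero, Matrix.cons_val_one] at h1
  have h2 : star (V a b) ≠ 0 := star_ne_zero.mpr hab
  rw [Matrix.smul_apply, smul_eq_mul, div_mul_eq_mul_div, eq_div_iff h2]
  linear_combination 2 * h1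

theorem injective_pureState_hadPi8_pow :
    Function.Injective fun j : ℕ => pureState (bellVec (hadPi8 ^ j)) := by
  intro j k h
  wlog hjk : j ≤ k generalizing j k
  · exact (this h.symm (by omega)).symm
  by_contra hne
  obtain ⟨c, hc⟩ := exists_smul_of_pureState_bellVec_eq (pow_mem hadPi8_mem_unitary k) h.symm
  obtain ⟨d, rfl⟩ := Nat.exists_eq_add_of_le hjk
  refine hadPi8_pow_ne_smul (d := d) (by omega) c ?_
  have hU := Matrix.mem_unitaryGroup_iff'.mp (pow_mem hadPi8_mem_unitary j)
  calc hadPi8 ^ d = star (hadPi8 ^ j) * hadPi8 ^ (j + d) := by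
        rw [pow_add, ← mul_assoc, hU, one_mul]
    _ = c • 1 := by rw [hc, Matrix.mul_smul, hU]

/-- A circuit that prepares a Bell state and applies a power of the product of the Hadamard and
the `π/8` gate to the first qubit. -/
def bellCircuit (j : ℕ) : List Gate :=
  [.had, .cnot] ++ (List.replicate j [.pi8, .had]).flatten

theorem onFirst_mulVec_bellVec (u V : Matrix (Fin 2) (Fin 2) ℂ) :
    (onFirst u).mulVec (bellVec V) = bellVec (u * V) := by
  funext ⟨a, b⟩
  simp only [Matrix.mulVec, dotProduct, onFirst, Matrix.kroneckerMap_apply, bellVec,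
    Matrix.mul_apply, Fintype.sum_prod_type, Matrix.one_apply]
  simp only [mul_ite, mul_one, mul_zero, ite_mul, zero_mul, Finset.sum_ite_eq, Finset.mem_univ,
    if_true, Finset.mul_sum]
  exact Finset.sum_congr rfl fun i _ => by ring

/-- The Hadamard gate and `cnot` make the Bell state, which is `bellVec 1`; each later pair, `pi8`
before `had`, multiplies the matrix on the left by `hadPi8`. -/
theorem foldl_bellCircuit (j : ℕ) :
    (bellCircuit j).foldl (fun φ G => G.matrix.mulVec φ) (Pi.single (0, 0) 1) =
      bellVec (hadPi8 ^ j) := by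
  have h0 : Gate.cnot.matrix.mulVec (Gate.had.matrix.mulVec (Pi.single (0, 0) 1)) = bellVec 1 := by
    rw [Matrix.mulVec_single_one]
    funext ⟨a, b⟩
    fin_cases a <;> fin_cases b <;>
      simp [Gate.matrix, onFirst, Matrix.mulVec, dotProduct, bellVec, Fintype.sum_prod_type]
  have hstep (k : ℕ) (V : Matrix (Fin 2) (Fin 2) ℂ) :
      (List.replicate k [Gate.pi8, Gate.had]).flatten.foldl (fun φ G => G.matrix.mulVec φ)
        (bellVec V) = bellVec (hadPi8 ^ k * V) := by
    induction k generalizing V with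
    | zero => simp
    | succ k ih =>
      rw [List.replicate_succ, List.flatten_cons, List.foldl_append]
      simp only [List.foldl_cons, List.foldl_nil]
      rw [show Gate.pi8.matrix = onFirst _ from rfl, show Gate.had.matrix = onFirst _ from rfl,
        onFirst_mulVec_bellVec, onFirst_mulVec_bellVec, ih, ← mul_assoc _ _ V, ← mul_assoc _ _ V,
        pow_succ]
      rfl
  rw [bellCircuit, List.foldl_append]
  simp only [List.foldl_cons, List.foldl_nil]
  rw [h0, hstep, mul_one]

/-! ### The trace distance and uniqueness of outputs -/

/-- The Frobenius norm lies in between: its square is Tr AᴴA, the sum of the squared singular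
values, which is at most the square of their sum. -/
theorem norm_apply_le_traceNorm {n : ℕ} (A : QMatrix n) (i j : Qubits n) :
    ‖A i j‖ ≤ traceNorm A := by
  have hpos := Matrix.posSemidef_conjTranspose_mul_self A
  have hnn : 0 ≤ traceNorm A := Finset.sum_nonneg fun _ _ => Real.sqrt_nonneg _
  refine abs_le_of_sq_le_sq' ?_ hnn |>.2
  have h1 : ∑ k, hpos.isHermitian.eigenvalues k ≤ traceNorm A ^ 2 := by
    refine le_trans (le_of_eq ?_)
      (Finset.sum_sq_le_sq_sum_of_nonneg fun k _ => Real.sqrt_nonneg _)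
    exact Finset.sum_congr rfl fun k _ => (Real.sq_sqrt (hpos.eigenvalues_nonneg k)).symm
  refine le_trans ?_ h1
  have h2 : ∑ k, hpos.isHermitian.eigenvalues k = ∑ k, ∑ l, ‖A l k‖ ^ 2 := by
    have h := hpos.isHermitian.trace_eq_sum_eigenvalues
    rw [← Complex.ofReal_inj]
    push_cast
    refine Eq.trans h.symm ?_
    simp only [Matrix.trace, Matrix.diag_apply, Matrix.mul_apply, Matrix.conjTranspose_apply]
    exact Finset.sum_congr rfl fun k _ => Finset.sum_congr rfl fun l _ => Complex.conj_mul' _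
  rw [h2]
  calc ‖A i j‖ ^ 2 ≤ ∑ l, ‖A l j‖ ^ 2 :=
        Finset.single_le_sum (f := fun l => ‖A l j‖ ^ 2) (fun _ _ => by positivity)
          (Finset.mem_univ i)
    _ ≤ _ := Finset.single_le_sum (f := fun k => ∑ l, ‖A l k‖ ^ 2) (fun _ _ => by positivity)
          (Finset.mem_univ j)

theorem traceDist_self {n : ℕ} (ρ : QMatrix n) : traceDist ρ ρ = 0 := by
  have h : traceNorm (ρ - ρ) = 0 := by
    rw [traceNorm]
    refine Finset.sum_eq_zero fun i _ => ?_
    have h0 := (Matrix.posSemidef_conjTranspose_mul_self (ρ - ρ)).isHermitian.eigenvalues_eq_zero_iff.mpr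
      (by simp)
    rw [h0]; simp
  rw [traceDist, h, zero_div]

namespace DcqTM

theorem iterate_step_of_halted (T : DcqTM) (c : T.Config) {t : ℕ}
    (h : (T.step^[t] c).state = T.halt) {s : ℕ} (hs : t ≤ s) : T.step^[s] c = T.step^[t] c := by
  obtain ⟨d, rfl⟩ := Nat.exists_eq_add_of_le' hs
  rw [Function.iterate_add_apply]
  refine Function.iterate_fixed ?_ d
  rw [step, if_pos h]

theorem Outputs.quantum_unique {T : DcqTM} {x : BString} {n : ℕ} {ρ : QMatrix n} {y y' : BString}
    {m : ℕ} {σ σ' : QMatrix m} (h : T.Outputs x ρ y σ) (h' : T.Outputs x ρ y' σ') : σ = σ' := by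
  obtain ⟨t, s, h1, -, -, -, rfl⟩ := h
  obtain ⟨t', s', h1', -, -, -, rfl⟩ := h'
  rcases le_total t t' with ht | ht
  · rw [iterate_step_of_halted T _ h1 ht]
  · rw [iterate_step_of_halted T _ h1' ht]

/-- A program computes at most one state of a given number of qubits. -/
theorem ComputesState.unique {T : DcqTM} {p : BString} {n : ℕ} {ρ ρ' : QMatrix n}
    (h : T.ComputesState p ρ) (h' : T.ComputesState p ρ') : ρ = ρ' := by
  ext i j
  -- Both states are within trace distance 1/(k+1) of the same output. Trace distance is half the
  -- trace norm, so each comparison costs 2/(k+1) per entry.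
  have hle (k : ℕ) : ‖ρ i j - ρ' i j‖ ≤ 4 * (1 / ((k : ℝ) + 1)) := by
    obtain ⟨y, σ, ho, hd⟩ := h (k + 1) k.succ_pos
    obtain ⟨y', σ', ho', hd'⟩ := h' (k + 1) k.succ_pos
    obtain rfl := ho.quantum_unique ho'
    have h1 := norm_apply_le_traceNorm (σ - ρ) i j
    have h2 := norm_apply_le_traceNorm (σ - ρ') i j
    rw [Matrix.sub_apply] at h1 h2
    rw [traceDist] at hd hd'
    push_cast at hd hd'
    have h3 : ‖ρ i j - ρ' i j‖ ≤ ‖σ i j - ρ i j‖ + ‖σ i j - ρ' i j‖ := by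
      rw [show ρ i j - ρ' i j = (σ i j - ρ' i j) - (σ i j - ρ i j) by ring, add_comm]
      exact norm_sub_le _ _
    linarith
  have hlim : Filter.Tendsto (fun k : ℕ => 4 * (1 / ((k : ℝ) + 1))) Filter.atTop (nhds 0) := by
    simpa using tendsto_one_div_add_atTop_nhds_zero_nat.const_mul (4 : ℝ)
  have h0 : ‖ρ i j - ρ' i j‖ ≤ 0 := ge_of_tendsto' hlim hle
  exact sub_eq_zero.mp (norm_le_zero_iff.mp h0)

theorem exists_computesState_of_complexity_le {T : DcqTM} {n : ℕ} {ρ : QMatrix n} {N : ℕ}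
    (h : T.complexity ρ ≤ N) : ∃ p : BString, p.length ≤ N ∧ T.ComputesState p ρ := by
  by_contra! hne
  have : ((N + 1 : ℕ) : ℕ∞) ≤ T.complexity ρ := by
    refine le_iInf₂ fun p hp => ?_
    by_contra hlt
    refine hne p ?_ hp
    have : p.length < N + 1 := by exact_mod_cast not_le.mp hlt
    omega
  have h2 : N + 1 ≤ N := by exact_mod_cast this.trans h
  omega

/-- Choosing a short program for each state is injective, since a program determines its state once
`n` is fixed; and there are finitely many strings of length at most `N`. -/
theorem finite_setOf_complexity_le (T : DcqTM) (n N : ℕ) :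
    {ρ : QMatrix n | T.complexity ρ ≤ N}.Finite := by
  choose! f hf using fun (ρ : QMatrix n) (h : T.complexity ρ ≤ N) =>
    exists_computesState_of_complexity_le h
  refine Set.Finite.of_finite_image (f := f) ?_ ?_
  · refine (List.finite_length_le Bool N).subset ?_
    rintro _ ⟨ρ, hρ, rfl⟩
    exact (hf ρ hρ).1
  · intro ρ hρ ρ' hρ' h
    exact (hf ρ hρ).2.unique (h ▸ (hf ρ' hρ').2)

/-! ### Upper bounds from circuits -/

theorem isState_emptyState : IsState emptyState :=
  ⟨Matrix.PosSemidef.one, by simp [emptyState, Matrix.trace_one]⟩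

/-- One program serves every `x`, so it may ignore the accuracy `k` as well as any classical
description supplied with it. -/
theorem IsUniversal.exists_program {U : DcqTM} (hU : U.IsUniversal) (gs : List Gate)
    (y s : BString) {m : ℕ} (hs : bitsValue s = m) :
    ∃ t : BString, ∀ x : BString, U.Outputs (encodeTuple [t, x]) emptyState y
      (readTape m (loadTape (pureState
        (gs.foldl (fun φ G => G.matrix.mulVec φ) (Pi.single (0, 0) 1))))) := by
  obtain ⟨T, hT⟩ := exists_outputs_circuit gs y s hs
  obtain ⟨t, ht⟩ := hU T
  refine ⟨t, fun x => (ht x 0 emptyState isState_emptyState _ _ _).mpr ?_⟩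
  have h := hT x 0 emptyState
  rwa [loadTape_emptyState, foldl_applyGate_loadTape] at h

theorem complexity_ne_top_of_outputs {U : DcqTM} {t : BString} {n : ℕ} {ρ : QMatrix n}
    {y : BString} (h : ∀ x, U.Outputs (encodeTuple [t, x]) emptyState y ρ) :
    U.complexity ρ ≠ ⊤ := by
  have hc : U.ComputesState t ρ := fun k _ => ⟨y, ρ, h _, by rw [traceDist_self]; positivity⟩
  exact ne_top_of_le_ne_top (ENat.natCast_ne_top t.length) (iInf₂_le t hc)

theorem IsUniversal.complexity_bellVec_ne_top {U : DcqTM} (hU : U.IsUniversal) (j : ℕ) :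
    U.complexity (pureState (bellVec (hadPi8 ^ j))) ≠ ⊤ := by
  -- The string `[false, true]` denotes 2, least significant bit first.
  obtain ⟨t, ht⟩ := hU.exists_program (bellCircuit j) [] [false, true] (m := 1 + 1) rfl
  rw [foldl_bellCircuit, readTape_loadTape_two] at ht
  exact complexity_ne_top_of_outputs ht

theorem IsUniversal.exists_outputs_mixedQubit {U : DcqTM} (hU : U.IsUniversal) :
    ∃ t : BString, ∀ x : BString, U.Outputs (encodeTuple [t, x]) emptyState [] mixedQubit := by
  obtain ⟨t, ht⟩ := hU.exists_program (bellCircuit 0) [] [true] (m := 1) rfl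
  rw [foldl_bellCircuit, readTape_loadTape_one, reducedA_bellVec (pow_mem hadPi8_mem_unitary 0)]
    at ht
  exact ⟨t, ht⟩

theorem IsUniversal.exists_computesReal {U : DcqTM} (hU : U.IsUniversal) (q : ℚ) :
    ∃ t : BString, U.ComputesReal t q := by
  obtain ⟨t, ht⟩ := hU.exists_program [] (encodeRat q) [] (m := 0) rfl
  exact ⟨t, fun k _ => ⟨q, by rw [sub_self, abs_zero]; positivity, 0, _, ht _⟩⟩

/-- Rational entries are computed by constant programs. Without a description the conditional
complexity would be `⊤` and the inequality trivial. -/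
theorem IsUniversal.exists_describes {U : DcqTM} (hU : U.IsUniversal) {n : ℕ} (ρ : QMatrix n)
    (hρ : ∀ v w, ∃ a b : ℚ, (ρ v w).re = a ∧ (ρ v w).im = b) : ∃ x, U.Describes x ρ := by
  choose a b ha hb using hρ
  choose f hf using fun q => hU.exists_computesReal q
  refine ⟨_, fun i j => f (a (basisLabel n i) (basisLabel n j)),
    fun i j => f (b (basisLabel n i) (basisLabel n j)), fun i j => ⟨?_, ?_⟩, rfl⟩
  · rw [ha]; exact hf _
  · rw [hb]; exact hf _

theorem IsUniversal.complexityGivenDescription_mixedQubit_ne_top {U : DcqTM}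
    (hU : U.IsUniversal) : U.complexityGivenDescription mixedQubit mixedQubit ≠ ⊤ := by
  obtain ⟨t, ht⟩ := hU.exists_outputs_mixedQubit
  have hd : ∃ x, U.Describes x mixedQubit := by
    refine hU.exists_describes _ fun v w => ⟨if v = w then 1 / 2 else 0, 0, ?_⟩
    rw [mixedQubit, Matrix.smul_apply, Matrix.one_apply]
    split_ifs <;> simp
  have hc : (∃ x, U.Describes x mixedQubit) ∧ ∀ x, U.Describes x mixedQubit →
      U.ComputesStateGiven t x emptyState mixedQubit :=
    ⟨hd, fun x _ k _ => ⟨[], mixedQubit, ht (encodeTuple [x, Nat.bits k]),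
      by rw [traceDist_self]; positivity⟩⟩
  exact ne_top_of_le_ne_top (ENat.natCast_ne_top t.length) (iInf₂_le t hc)

end DcqTM

/-! ### Growth comparison and contradiction -/

theorem eventually_add_mul_logb_lt (C g : ℝ) :
    ∀ᶠ N : ℕ in Filter.atTop, C + g * Real.logb 2 (2 * N) < N := by
  have hlog := Real.log_pos one_lt_two
  -- At x = 2N this factor bounds the logarithmic term by N/2, leaving the other half for C; the 1
  -- added to |g| avoids division by zero.
  have h1 : ∀ᶠ x : ℝ in Filter.atTop, ‖Real.log x‖ ≤ Real.log 2 / (4 * (|g| + 1)) * ‖id x‖ :=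
    Real.isLittleO_log_id_atTop.bound (by positivity)
  have h2 : Filter.Tendsto (fun N : ℕ => 2 * (N : ℝ)) Filter.atTop Filter.atTop :=
    tendsto_natCast_atTop_atTop.const_mul_atTop two_pos
  filter_upwards [h2.eventually h1, Filter.eventually_gt_atTop ⌈2 * |C|⌉₊] with N hN hC
  have hC' : 2 * |C| < N := (Nat.le_ceil _).trans_lt (by exact_mod_cast hC)
  have h3 : g * Real.logb 2 (2 * N) ≤ N / 2 := by
    rw [id, Real.norm_eq_abs, Real.norm_eq_abs, abs_of_nonneg (by positivity : (0:ℝ) ≤ 2 * N)] at hN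
    calc g * Real.logb 2 (2 * N) ≤ |g| * (|Real.log (2 * N)| / Real.log 2) := by
          rw [Real.logb]
          refine (le_abs_self _).trans (le_of_eq ?_)
          rw [abs_mul, abs_div, abs_of_pos hlog]
      _ ≤ (|g| + 1) * (Real.log 2 / (4 * (|g| + 1)) * (2 * N) / Real.log 2) := by
          gcongr; linarith
      _ = N / 2 := by field_simp; ring
  have := le_abs_self C
  linarith

end

theorem theorem4 (U : DcqTM) (hU : U.IsUniversal) :
    ¬ ∃ g : ℝ, ∀ nA nB : ℕ, 1 ≤ nA → 1 ≤ nB →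
      ∀ ρ : QMatrix (nA + nB), IsState ρ → U.complexity ρ ≠ ⊤ →
        (U.complexity ρ : EReal) ≤
          (U.complexity (reducedA ρ) : EReal) +
            (U.complexityGivenDescription (reducedB ρ) (reducedA ρ) : EReal) +
            ((g * Real.logb 2 ((nA + nB : ℕ) * (U.complexity ρ).toNat : ℝ) : ℝ) : EReal) := by
  rintro ⟨g, hg⟩
  obtain ⟨a, ha⟩ : ∃ a : ℕ, U.complexity mixedQubit = a := by
    obtain ⟨t, ht⟩ := hU.exists_outputs_mixedQubit
    exact ⟨_, (ENat.natCast_toNat (DcqTM.complexity_ne_top_of_outputs ht)).symm⟩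
  obtain ⟨b, hb⟩ : ∃ b : ℕ, U.complexityGivenDescription mixedQubit mixedQubit = b :=
    ⟨_, (ENat.natCast_toNat hU.complexityGivenDescription_mixedQubit_ne_top).symm⟩
  -- The threshold depends only on `a`, `b` and `g`, hence works for all `j` at once.
  obtain ⟨N₀, hN₀⟩ := Filter.eventually_atTop.mp (eventually_add_mul_logb_lt (a + b) g)
  have hle (j : ℕ) : U.complexity (pureState (bellVec (hadPi8 ^ j))) ≤ N₀ := by
    have hV := pow_mem hadPi8_mem_unitary j
    have htop := hU.complexity_bellVec_ne_top j
    have h := hg 1 1 le_rfl le_rfl _ (isState_bellVec hV) htop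
    rw [reducedA_bellVec hV, reducedB_bellVec hV, ha, hb] at h
    obtain ⟨N, hN⟩ : ∃ N : ℕ, U.complexity (pureState (bellVec (hadPi8 ^ j))) = N :=
      ⟨_, (ENat.natCast_toNat htop).symm⟩
    rw [hN] at h ⊢
    have h' : (N : ℝ) ≤ a + b + g * Real.logb 2 (2 * N) := by
      rw [ENat.toNat_natCast] at h
      have hcast (k : ℕ) : ((k : ℕ∞) : EReal) = ((k : ℝ) : EReal) := rfl
      rw [hcast, hcast, hcast, ← EReal.coe_add, ← EReal.coe_add, EReal.coe_le_coe_iff] at h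
      push_cast at h
      exact h
    by_contra hlt
    have hlt' : N₀ < N := by exact_mod_cast not_le.mp hlt
    linarith [hN₀ N hlt'.le]
  exact (Set.infinite_range_of_injective injective_pureState_hadPi8_pow)
    ((U.finite_setOf_complexity_le (1 + 1) N₀).subset (Set.range_subset_iff.mpr hle))
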